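/- Let $n\ge 1$, let $\lambda_0,\dots,\lambda_n\in\mathbb C$ with $\lambda_0=\lambda_1\in\mathbb R$, and let $$E=E_{(\lambda_0,\dots,\lambda_n)}=\Big\{f\in C^\infty(\mathbb R,\mathbb C): \Big(\tfrac{d}{dx}-\lambda_0\Big)\cdots\Big(\tfrac{d}{dx}-\lambda_n\Big)f=0\Big\}.$$ Suppose that $E$ is closed under complex conjugation ($f\in E\Rightarrow\overline f\in E$), and let $a,b\in\mathbb R$ satisfy $0<b-a<\pi/M_n$, where $M_n=\max\{|\operatorname{Im}\lambda_j|:0\le j\le n\}$ and $\pi/0:=\infty$. Then $E$ has a unique Bernstein basis with respect to $a,b$, that is, there are unique functions $p_{n,0},\dots,p_{n,n}\in E$ such that each $p_{n,k}$ has a zero of order exactly $k$ at $a$ and a zero of order exactly $n-k$ at $b$, and $p_{n,k}^{(k)}(a)=1$. Moreover, there exist unique nodes $a=t_0\le t_1\le\dots\le t_n=b$ and unique positive real numbers $\alpha_0,\dots,\alpha_n$ such that the operator $B$ defined for complex-valued $f\in C[a,b]$ by $$Bf=\sum_{k=0}^n\alpha_k f(t_k)\,p_{n,k}$$ fixes the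 functions $e^{\lambda_0x}$ and $xe^{\lambda_0x}$. (The two identities hold for all $x\in\mathbb R$, and already their validity for all $x\in[a,b]$ determines the nodes and weights.) -/

import Mathlib

open scoped ContDiff ComplexConjugate

noncomputable section

namespace ExpBernstein

/-- The first order operator `d/dx - c` on functions `ℝ → ℂ`. -/
def firstOrderOp (c : ℂ) (f : ℝ → ℂ) : ℝ → ℂ := fun x => deriv f x - c * f x

/-- The operator `L = (d/dx - λ₀) ⋯ (d/dx - λₙ)`. -/
def diffOp {n : ℕ} (Λ : Fin (n + 1) → ℂ) (f : ℝ → ℂ) : ℝ → ℂ :=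
  (List.ofFn Λ).foldr firstOrderOp f

/-- The space `E_(λ₀,…,λₙ)` of exponential polynomials: smooth `f : ℝ → ℂ` with `L f = 0`. -/
def expSpace {n : ℕ} (Λ : Fin (n + 1) → ℂ) : Set (ℝ → ℂ) :=
  {f | ContDiff ℝ ∞ f ∧ ∀ x, diffOp Λ f x = 0}

/-- A set of complex-valued functions is closed under complex conjugation. -/
def ClosedUnderConj (U : Set (ℝ → ℂ)) : Prop :=
  ∀ f ∈ U, (fun x => conj (f x)) ∈ U

/-- `f` has a zero of order (exactly) `k` at `c`. -/
def HasZeroOfOrder (f : ℝ → ℂ) (k : ℕ) (c : ℝ) : Prop :=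
  (∀ j < k, iteratedDeriv j f c = 0) ∧ iteratedDeriv k f c ≠ 0

/-- `p` is the (normalized) Bernstein basis of `E_(λ₀,…,λₙ)` with respect to `a`, `b`: `p k` lies
in the space, has a zero of order `k` at `a` and of order `n - k` at `b`, and its `k`-th derivative
at `a` is `1`. -/
def IsBernsteinBasis {n : ℕ} (Λ : Fin (n + 1) → ℂ) (a b : ℝ) (p : Fin (n + 1) → ℝ → ℂ) : Prop :=
  ∀ k : Fin (n + 1), p k ∈ expSpace Λ ∧
    HasZeroOfOrder (p k) (k : ℕ) a ∧ HasZeroOfOrder (p k) (n - (k : ℕ)) b ∧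
    iteratedDeriv (k : ℕ) (p k) a = 1

/-- `Mₙ = max {|Im λⱼ| : j = 0, …, n}`. -/
def maxAbsIm {n : ℕ} (Λ : Fin (n + 1) → ℂ) : ℝ :=
  Finset.univ.sup' Finset.univ_nonempty (fun j => |(Λ j).im|)

/-- The operator `B f = ∑ₖ αₖ f(tₖ) pₖ` for `f ∈ C[a,b]`; the values are functions on `ℝ`. -/
def bernsteinOp {n : ℕ} {a b : ℝ} (p : Fin (n + 1) → ℝ → ℂ) (t : Fin (n + 1) → Set.Icc a b)
    (α : Fin (n + 1) → ℝ) (f : C(Set.Icc a b, ℂ)) : ℝ → ℂ :=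
  fun x => ∑ k, (α k : ℂ) * f (t k) * p k x

/-- Admissible data: `a = t₀ ≤ t₁ ≤ … ≤ tₙ = b` and `αₖ > 0` for all `k`. -/
def AdmissibleData {n : ℕ} {a b : ℝ} (t : Fin (n + 1) → Set.Icc a b) (α : Fin (n + 1) → ℝ) : Prop :=
  (t 0 : ℝ) = a ∧ (t (Fin.last n) : ℝ) = b ∧ Monotone t ∧ ∀ k, 0 < α k

/-- The operator `B` reproduces `g` on the set `S`. -/
def FixesOn {n : ℕ} {a b : ℝ} (p : Fin (n + 1) → ℝ → ℂ) (t : Fin (n + 1) → Set.Icc a b)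
    (α : Fin (n + 1) → ℝ) (g : C(ℝ, ℂ)) (S : Set ℝ) : Prop :=
  ∀ x ∈ S, bernsteinOp p t α (g.restrict (Set.Icc a b)) x = g x

/-- The function `x ↦ e^{c x}`. -/
def expFun (c : ℂ) : C(ℝ, ℂ) := ⟨fun x => Complex.exp (c * x), by fun_prop⟩

/-- The function `x ↦ x e^{c x}`. -/
def mulExpFun (c : ℂ) : C(ℝ, ℂ) := ⟨fun x => (x : ℂ) * Complex.exp (c * x), by fun_prop⟩

end ExpBernstein

end

/-! Closure under conjugation makes the characteristic polynomial `P` real, so the problem reduces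
to real solutions of `P(D) g = 0`. The engine is a zero count (`eq_zero_of_zeros`): since `|Im z| (b
- a) < π` for every root `z`, a nonzero real solution has fewer than `deg P` zeros in `[a, b]`, with
multiplicity counted at the endpoints. It follows by induction on `deg P`, splitting off a real
linear or quadratic factor and applying Rolle's theorem to suitable quotients. The count yields the
Bernstein basis, its uniqueness, its positivity on `(a, b)` and the signs of its leading derivatives
at `b`.

Let `r = λ₀`, and let `p k` and `q k` be the Bernstein bases for `P = (X - r) Q` and for `Q`. Then
`(D - r) p k = q (k-1) + β k • q k` with `β k < 0` (`exists_derivative_coeff`). Write `e^{rx} = ∑ c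
k • p k` and `x e^{rx} = ∑ d k • p k`. Since `(D - r) e^{rx} = 0`, `c (k+1) = -β k * c k`, so all `c
k > 0`. Since `(D - r)(x e^{rx}) = e^{rx}` has positive coefficients `γ k` in the basis `q`, which
uses the second factor `X - r`, the ratios satisfy `d (k+1) / c (k+1) = d k / c k + γ k / c (k+1)`
and increase. Fixing both functions means `α k e^{r t k} = c k` and `α k (t k) e^{r t k} = d k`,
which forces `t k = d k / c k` and `α k = c k e^{-r t k}`. -/

namespace ExpBernstein

open Polynomial

/-! ### Polynomials in `D` acting on smooth functions. -/

section Smooth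

variable {𝕜 : Type*} [RCLike 𝕜]

variable (𝕜) in
/-- The space of smooth functions `ℝ → 𝕜`. -/
def smoothFun : Submodule 𝕜 (ℝ → 𝕜) where
  carrier := {f | ContDiff ℝ ∞ f}
  add_mem' {f g} (hf : ContDiff ℝ ∞ f) (hg : ContDiff ℝ ∞ g) := hf.add hg
  zero_mem' := (contDiff_const : ContDiff ℝ ∞ fun _ => (0 : 𝕜))
  smul_mem' c f (hf : ContDiff ℝ ∞ f) := hf.const_smul c

theorem smoothFun_contDiff (f : smoothFun 𝕜) : ContDiff ℝ ∞ f.1 := f.2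

theorem smoothFun_differentiable (f : smoothFun 𝕜) : Differentiable ℝ f.1 :=
  (smoothFun_contDiff f).differentiable (by simp)

variable (𝕜) in
/-- Differentiation as an endomorphism of the space of smooth functions. -/
noncomputable def derivOp : Module.End 𝕜 (smoothFun 𝕜) where
  toFun f := ⟨deriv f.1, (contDiff_infty_iff_deriv.1 (smoothFun_contDiff f)).2⟩
  map_add' f g := by
    ext x
    exact deriv_add (smoothFun_differentiable f x) (smoothFun_differentiable g x)
  map_smul' c f := by
    ext x
    exact deriv_const_smul c (smoothFun_differentiable f x)

/-- The functional `f ↦ f⁽ʲ⁾(x)`. -/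
noncomputable def jet (x : ℝ) (j : ℕ) : smoothFun 𝕜 →ₗ[𝕜] 𝕜 :=
  (LinearMap.proj x ∘ₗ (smoothFun 𝕜).subtype) ∘ₗ (derivOp 𝕜 ^ j)

theorem jet_apply (x : ℝ) (j : ℕ) (f : smoothFun 𝕜) : jet x j f = ((derivOp 𝕜 ^ j) f).1 x := rfl

theorem jet_zero (x : ℝ) (f : smoothFun 𝕜) : jet x 0 f = f.1 x := rfl

theorem jet_derivOp (x : ℝ) (j : ℕ) (f : smoothFun 𝕜) :
    jet x j (derivOp 𝕜 f) = jet x (j + 1) f := by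
  rw [jet_apply, jet_apply, pow_succ]; rfl

theorem coe_derivOp_pow (j : ℕ) (f : smoothFun 𝕜) :
    ((derivOp 𝕜 ^ j) f).1 = iteratedDeriv j f.1 := by
  induction j generalizing f with
  | zero => simp
  | succ j ih => rw [pow_succ, Module.End.mul_apply, ih, iteratedDeriv_succ']; rfl

theorem jet_eq_iteratedDeriv (x : ℝ) (j : ℕ) (f : smoothFun 𝕜) :
    jet x j f = iteratedDeriv j f.1 x := by
  rw [jet_apply, coe_derivOp_pow]

theorem hasDerivAt_jet (x : ℝ) (j : ℕ) (f : smoothFun 𝕜) :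
    HasDerivAt (fun y => jet y j f) (jet x (j + 1) f) x := by
  have h := (smoothFun_differentiable ((derivOp 𝕜 ^ j) f) x).hasDerivAt
  rw [jet_apply, pow_succ']
  exact h

theorem smoothFun_hasDerivAt (f : smoothFun 𝕜) (x : ℝ) : HasDerivAt f.1 (jet x 1 f) x :=
  hasDerivAt_jet x 0 f

theorem jet_aeval (P : 𝕜[X]) (x : ℝ) (j : ℕ) (f : smoothFun 𝕜) :
    jet x j (aeval (derivOp 𝕜) P f) =
      ∑ k ∈ Finset.range (P.natDegree + 1), P.coeff k * jet x (j + k) f := by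
  rw [aeval_eq_sum_range, LinearMap.sum_apply, map_sum]
  refine Finset.sum_congr rfl fun k _ => ?_
  rw [LinearMap.smul_apply, map_smul, smul_eq_mul, jet_apply, jet_apply, pow_add]
  rfl

/-- Applying `P(D)` lowers the order of a zero by at most `deg P`. -/
theorem jet_aeval_eq_zero {P : 𝕜[X]} {d : ℕ} (hP : P.natDegree ≤ d) {x : ℝ} {i : ℕ}
    {f : smoothFun 𝕜} (hf : ∀ j < i, jet x j f = 0) :
    ∀ j < i - d, jet x j (aeval (derivOp 𝕜) P f) = 0 := by
  intro j hj
  rw [jet_aeval]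
  refine Finset.sum_eq_zero fun k hk => ?_
  rw [Finset.mem_range] at hk
  rw [hf _ (by omega), mul_zero]

theorem aeval_X_sub_C_apply (c : 𝕜) (f : smoothFun 𝕜) :
    aeval (derivOp 𝕜) (X - C c) f = derivOp 𝕜 f - c • f := by
  simp [Module.algebraMap_end_apply]

theorem jet_X_sub_C (c : 𝕜) (x : ℝ) (j : ℕ) (f : smoothFun 𝕜) :
    jet x j (aeval (derivOp 𝕜) (X - C c) f) = jet x (j + 1) f - c * jet x j f := by
  rw [aeval_X_sub_C_apply, map_sub, jet_derivOp, map_smul, smul_eq_mul]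

end Smooth

/-! ### Initial value problems for `P(D) f = 0` over `ℂ`. -/

section Complex

theorem contDiff_cexp (c : ℂ) : ContDiff ℝ ∞ (fun x : ℝ => Complex.exp (c * x)) :=
  (contDiff_const.mul Complex.ofRealCLM.contDiff).cexp

theorem hasDerivAt_cexp (c : ℂ) (x : ℝ) :
    HasDerivAt (fun x : ℝ => Complex.exp (c * x)) (c * Complex.exp (c * x)) x := by
  have h : HasDerivAt (fun x : ℝ => c * (x : ℂ)) (c * 1) x :=
    (Complex.ofRealCLM.hasDerivAt (x := x)).const_mul c
  convert h.cexp using 1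
  ring

theorem eq_zero_of_first_order {c : ℂ} {f : smoothFun ℂ}
    (hf : aeval (derivOp ℂ) (X - C c) f = 0) {x₀ : ℝ} (h0 : f.1 x₀ = 0) : f = 0 := by
  have h1 (x : ℝ) : jet x 1 f = c * f.1 x := by
    have := jet_X_sub_C c x 0 f
    rw [hf, map_zero, jet_zero] at this
    exact (sub_eq_zero.1 this.symm)
  have hd (x : ℝ) : HasDerivAt (fun x : ℝ => Complex.exp (-c * x) * f.1 x) 0 x := by
    refine ((hasDerivAt_cexp (-c) x).mul (smoothFun_hasDerivAt f x)).congr_deriv ?_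
    rw [h1]; ring
  have hc := is_const_of_deriv_eq_zero (fun x => (hd x).differentiableAt) (fun x => (hd x).deriv)
  ext x
  have := hc x x₀
  simpa [h0, Complex.exp_ne_zero] using this

/-- Uniqueness for the initial value problem of `P(D) f = 0`. -/
theorem eq_zero_of_jet_eq_zero {P : ℂ[X]} (hP : P ≠ 0) {f : smoothFun ℂ}
    (hf : aeval (derivOp ℂ) P f = 0) {x₀ : ℝ} (h0 : ∀ j < P.natDegree, jet x₀ j f = 0) :
    f = 0 := by
  induction hd : P.natDegree generalizing P f with
  | zero =>
    obtain ⟨a, rfl⟩ := natDegree_eq_zero.1 hd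
    rw [aeval_C, Module.algebraMap_end_apply] at hf
    exact (smul_eq_zero.1 hf).resolve_left (by simpa using hP)
  | succ d ih =>
    obtain ⟨c, hc⟩ := IsAlgClosed.exists_root P (by
      rw [degree_eq_natDegree hP, hd]; exact_mod_cast d.succ_ne_zero)
    obtain ⟨Q, rfl⟩ := dvd_iff_isRoot.2 hc
    have hQ : Q ≠ 0 := right_ne_zero_of_mul hP
    rw [natDegree_mul (X_sub_C_ne_zero c) hQ, natDegree_X_sub_C] at hd h0
    refine eq_zero_of_first_order (c := c) (ih hQ ?_ ?_ (by omega)) (h0 0 (by omega))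
    · rwa [mul_comm, map_mul, Module.End.mul_apply] at hf
    · intro j hj
      rw [jet_X_sub_C, h0 _ (by omega), h0 _ (by omega), mul_zero, sub_zero]

/-- Variation of constants: the solution is `e^{cx}` times a primitive of `e^{-cx} h`, adjusted at
`x₀`. -/
theorem exists_first_order (c : ℂ) (h : smoothFun ℂ) (x₀ : ℝ) (y : ℂ) :
    ∃ f : smoothFun ℂ, aeval (derivOp ℂ) (X - C c) f = h ∧ f.1 x₀ = y := by
  have hcont : ContDiff ℝ ∞ (fun x : ℝ => Complex.exp (-c * x) * h.1 x) :=
    (contDiff_cexp (-c)).mul (smoothFun_contDiff h)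
  let I : ℝ → ℂ := fun x => ∫ t in x₀..x, Complex.exp (-c * t) * h.1 t
  have hI (x : ℝ) : HasDerivAt I (Complex.exp (-c * x) * h.1 x) x :=
    intervalIntegral.integral_hasDerivAt_right (hcont.continuous.intervalIntegrable _ _)
      (hcont.continuous.stronglyMeasurableAtFilter _ _) hcont.continuous.continuousAt
  have hIs : ContDiff ℝ ∞ I := by
    refine contDiff_infty_iff_deriv.2 ⟨fun x => (hI x).differentiableAt, ?_⟩
    rwa [show deriv I = _ from funext fun x => (hI x).deriv]
  let f : smoothFun ℂ := ⟨fun x => Complex.exp (c * x) * (y * Complex.exp (-c * x₀) + I x),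
    (contDiff_cexp c).mul (contDiff_const.add hIs)⟩
  have hexp (x : ℝ) : Complex.exp (c * x) * Complex.exp (-c * x) = 1 := by
    rw [← Complex.exp_add]; simp
  refine ⟨f, ?_, ?_⟩
  · ext x
    have hd := ((hasDerivAt_cexp c x).mul ((hI x).const_add (y * Complex.exp (-c * x₀))))
    have hj := jet_X_sub_C c x 0 f
    rw [(smoothFun_hasDerivAt f x).unique hd] at hj
    rw [← jet_zero, hj, jet_zero]
    change _ - c * (Complex.exp (c * x) * (y * Complex.exp (-c * x₀) + I x)) = _
    linear_combination (h.1 x) * hexp x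
  · change Complex.exp (c * x₀) * (y * Complex.exp (-c * x₀) + I x₀) = y
    have : I x₀ = 0 := intervalIntegral.integral_same
    rw [this]
    linear_combination y * hexp x₀

/-- Existence for the initial value problem of `P(D) f = 0`. -/
theorem exists_jet_eq {P : ℂ[X]} (hP : P ≠ 0) (x₀ : ℝ) (y : ℕ → ℂ) :
    ∃ f : smoothFun ℂ, aeval (derivOp ℂ) P f = 0 ∧ ∀ j < P.natDegree, jet x₀ j f = y j := by
  induction hd : P.natDegree generalizing P y with
  | zero => exact ⟨0, map_zero _, fun j hj => absurd hj j.not_lt_zero⟩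
  | succ d ih =>
    obtain ⟨c, hc⟩ := IsAlgClosed.exists_root P (by
      rw [degree_eq_natDegree hP, hd]; exact_mod_cast d.succ_ne_zero)
    obtain ⟨Q, rfl⟩ := dvd_iff_isRoot.2 hc
    have hQ : Q ≠ 0 := right_ne_zero_of_mul hP
    rw [natDegree_mul (X_sub_C_ne_zero c) hQ, natDegree_X_sub_C] at hd
    -- The jets that `(D - c) f` must have if those of `f` are to be `y`.
    obtain ⟨h, hh, hj⟩ := ih hQ (fun j => y (j + 1) - c * y j) (by omega)
    obtain ⟨f, hf, h0⟩ := exists_first_order c h x₀ (y 0)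
    refine ⟨f, ?_, fun j hjd => ?_⟩
    · rw [mul_comm, map_mul, Module.End.mul_apply, hf, hh]
    · induction j with
      | zero => exact h0
      | succ j ihj =>
        have h1 := jet_X_sub_C c x₀ j f
        rw [hf, hj j (by omega), ihj (by omega)] at h1
        exact (sub_left_inj.1 h1).symm

end Complex

/-! ### Transfer to real solutions. -/

section Real

/-- The real part of a smooth function. -/
noncomputable def reMap : smoothFun ℂ →ₗ[ℝ] smoothFun ℝ where
  toFun f := ⟨fun x => (f.1 x).re, Complex.reCLM.contDiff.comp (smoothFun_contDiff f)⟩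
  map_add' _ _ := rfl
  map_smul' c f := by ext x; simp

/-- The inclusion of the real smooth functions into the complex ones. -/
noncomputable def ofRealMap : smoothFun ℝ →ₗ[ℝ] smoothFun ℂ where
  toFun f := ⟨fun x => (f.1 x : ℂ), Complex.ofRealCLM.contDiff.comp (smoothFun_contDiff f)⟩
  map_add' f g := by ext x; exact Complex.ofReal_add _ _
  map_smul' c f := by ext x; simp

theorem jet_reMap (x : ℝ) (j : ℕ) (f : smoothFun ℂ) : jet x j (reMap f) = (jet x j f).re := by
  induction j generalizing x with
  | zero => rfl
  | succ j ih =>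
    refine (hasDerivAt_jet x j (reMap f)).unique ?_
    simp_rw [ih]
    exact Complex.reCLM.hasFDerivAt.comp_hasDerivAt x (hasDerivAt_jet x j f)

theorem jet_ofRealMap (x : ℝ) (j : ℕ) (f : smoothFun ℝ) :
    jet x j (ofRealMap f) = ((jet x j f : ℝ) : ℂ) := by
  induction j generalizing x with
  | zero => rfl
  | succ j ih =>
    refine (hasDerivAt_jet x j (ofRealMap f)).unique ?_
    simp_rw [ih]
    exact Complex.ofRealCLM.hasFDerivAt.comp_hasDerivAt x (hasDerivAt_jet x j f)

theorem aeval_reMap (P : ℝ[X]) (f : smoothFun ℂ) :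
    aeval (derivOp ℝ) P (reMap f) = reMap (aeval (derivOp ℂ) (P.map (algebraMap ℝ ℂ)) f) := by
  ext x
  rw [← jet_zero, ← jet_zero, jet_reMap, jet_aeval, jet_aeval, Complex.re_sum,
    natDegree_map]
  refine Finset.sum_congr rfl fun k _ => ?_
  rw [jet_reMap, coeff_map]
  simp

theorem aeval_ofRealMap (P : ℝ[X]) (f : smoothFun ℝ) :
    aeval (derivOp ℂ) (P.map (algebraMap ℝ ℂ)) (ofRealMap f) =
      ofRealMap (aeval (derivOp ℝ) P f) := by
  ext x
  rw [← jet_zero, ← jet_zero, jet_ofRealMap, jet_aeval, jet_aeval, Complex.ofReal_sum,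
    natDegree_map]
  refine Finset.sum_congr rfl fun k _ => ?_
  rw [jet_ofRealMap, coeff_map]
  simp

theorem ofRealMap_injective : Function.Injective ofRealMap := by
  intro f g h
  ext x
  have : ((ofRealMap f).1 x) = (ofRealMap g).1 x := by rw [h]
  exact Complex.ofReal_injective this

theorem eq_zero_of_jet_eq_zero_real {P : ℝ[X]} (hP : P ≠ 0) {f : smoothFun ℝ}
    (hf : aeval (derivOp ℝ) P f = 0) {x₀ : ℝ} (h0 : ∀ j < P.natDegree, jet x₀ j f = 0) :
    f = 0 := by
  refine ofRealMap_injective ((eq_zero_of_jet_eq_zero (x₀ := x₀) (P := P.map (algebraMap ℝ ℂ))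
    ?_ ?_ ?_).trans (map_zero _).symm)
  · exact (Polynomial.map_ne_zero_iff (algebraMap ℝ ℂ).injective).2 hP
  · rw [aeval_ofRealMap, hf, map_zero]
  · intro j hj
    rw [natDegree_map] at hj
    rw [jet_ofRealMap, h0 j hj, Complex.ofReal_zero]

theorem exists_jet_eq_real {P : ℝ[X]} (hP : P ≠ 0) (x₀ : ℝ) (y : ℕ → ℝ) :
    ∃ f : smoothFun ℝ, aeval (derivOp ℝ) P f = 0 ∧ ∀ j < P.natDegree, jet x₀ j f = y j := by
  obtain ⟨f, hf, hj⟩ := exists_jet_eq (P := P.map (algebraMap ℝ ℂ))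
    ((Polynomial.map_ne_zero_iff (algebraMap ℝ ℂ).injective).2 hP) x₀ (fun j => (y j : ℂ))
  refine ⟨reMap f, ?_, fun j hjd => ?_⟩
  · rw [aeval_reMap, hf, map_zero]
  · rw [jet_reMap, hj j (by rwa [natDegree_map]), Complex.ofReal_re]

end Real

/-! ### Counting zeros by Rolle's theorem. -/

section Zeros

variable {a b : ℝ}

/-- Counting form of Rolle's theorem for a set of points of `(a, b)` and possibly the endpoints. -/
theorem exists_zeros_of_rolle (hab : a < b) {φ ψ : ℝ → ℝ}
    (h : ∀ x ∈ Set.Icc a b, ∀ y ∈ Set.Icc a b, x < y → φ x = 0 → φ y = 0 →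
      ∃ z ∈ Set.Ioo x y, ψ z = 0)
    {S : Finset ℝ} (hS : ∀ x ∈ S, x ∈ Set.Ioo a b) (hφ : ∀ x ∈ S, φ x = 0) {i j : ℕ}
    (hi : 0 < i → φ a = 0) (hj : 0 < j → φ b = 0) :
    ∃ T : Finset ℝ, (∀ x ∈ T, x ∈ Set.Ioo a b) ∧ (∀ x ∈ T, ψ x = 0) ∧
      min i 1 + S.card + min j 1 ≤ T.card + 1 := by
  classical
  obtain ⟨S', hS', hφ', hcard⟩ : ∃ S' : Finset ℝ, (∀ x ∈ S', x ∈ Set.Icc a b) ∧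
      (∀ x ∈ S', φ x = 0) ∧ min i 1 + S.card + min j 1 ≤ S'.card := by
    have haS : a ∉ S := fun h => lt_irrefl a (hS a h).1
    have hbS : b ∉ S := fun h => lt_irrefl b (hS b h).2
    have hS1 : ∀ x ∈ S, x ∈ Set.Icc a b := fun x hx => Set.Ioo_subset_Icc_self (hS x hx)
    have ha : a ∈ Set.Icc a b := Set.left_mem_Icc.2 hab.le
    have hb : b ∈ Set.Icc a b := Set.right_mem_Icc.2 hab.le
    have hins {x : ℝ} {U : Finset ℝ} {p : ℝ → Prop} (h : p x ∧ ∀ y ∈ U, p y) :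
        ∀ y ∈ insert x U, p y := (Finset.forall_mem_insert _ _ _).2 h
    rcases Nat.eq_zero_or_pos i with rfl | hi0 <;> rcases Nat.eq_zero_or_pos j with rfl | hj0
    · exact ⟨S, hS1, hφ, by simp⟩
    · exact ⟨insert b S, hins ⟨hb, hS1⟩, hins ⟨hj hj0, hφ⟩, by
        rw [Finset.card_insert_of_notMem hbS]; omega⟩
    · exact ⟨insert a S, hins ⟨ha, hS1⟩, hins ⟨hi hi0, hφ⟩, by
        rw [Finset.card_insert_of_notMem haS]; omega⟩
    · refine ⟨insert a (insert b S), hins ⟨ha, hins ⟨hb, hS1⟩⟩,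
        hins ⟨hi hi0, hins ⟨hj hj0, hφ⟩⟩, ?_⟩
      rw [Finset.card_insert_of_notMem (by simp [haS, hab.ne]),
        Finset.card_insert_of_notMem hbS]
      omega
  let Z : Set ℝ := {z | z ∈ Set.Ioo a b ∧ ψ z = 0}
  -- Finiteness is needed only for the interleaving count; an infinite zero set contains finite
  -- subsets of any size.
  by_cases hZ : Z.Finite
  · refine ⟨hZ.toFinset, fun x hx => (hZ.mem_toFinset.1 hx).1,
      fun x hx => (hZ.mem_toFinset.1 hx).2, hcard.trans ?_⟩
    refine Finset.card_le_of_interleaved fun x hx y hy hxy _ => ?_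
    obtain ⟨z, hz, hz0⟩ := h x (hS' x hx) y (hS' y hy) hxy (hφ' x hx) (hφ' y hy)
    exact ⟨z, hZ.mem_toFinset.2 ⟨⟨(hS' x hx).1.trans_lt hz.1, hz.2.trans_le (hS' y hy).2⟩, hz0⟩,
      hz.1, hz.2⟩
  · obtain ⟨T, hT, hTc⟩ := Set.Infinite.exists_subset_card_eq hZ (min i 1 + S.card + min j 1)
    exact ⟨T, fun x hx => (hT hx).1, fun x hx => (hT hx).2, by omega⟩

theorem hasDerivAt_exp_mul (c x : ℝ) :
    HasDerivAt (fun x : ℝ => Real.exp (c * x)) (c * Real.exp (c * x)) x := by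
  have h : HasDerivAt (fun x : ℝ => c * x) (c * 1) x := (hasDerivAt_id x).const_mul c
  convert h.exp using 1
  ring

/-- Rolle's theorem for `d/dx - c`. -/
theorem rolle_first_order (c : ℝ) (g : smoothFun ℝ) {x y : ℝ} (hxy : x < y)
    (hx : g.1 x = 0) (hy : g.1 y = 0) :
    ∃ z ∈ Set.Ioo x y, (aeval (derivOp ℝ) (X - C c) g).1 z = 0 := by
  have hd (t : ℝ) : HasDerivAt (fun t => Real.exp (-c * t) * g.1 t)
      (Real.exp (-c * t) * (aeval (derivOp ℝ) (X - C c) g).1 t) t := by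
    refine ((hasDerivAt_exp_mul (-c) t).mul (smoothFun_hasDerivAt g t)).congr_deriv ?_
    rw [← jet_zero t (aeval (derivOp ℝ) (X - C c) g), jet_X_sub_C, jet_zero]
    ring
  obtain ⟨z, hz, h0⟩ := exists_hasDerivAt_eq_zero hxy
    (fun t _ => (hd t).continuousAt.continuousWithinAt) (by simp [hx, hy]) (fun t _ => hd t)
  exact ⟨z, hz, (mul_eq_zero.1 h0).resolve_left (Real.exp_ne_zero _)⟩

/-- The Wronskian of `g` and `e^{αx} cos (β (x - m))`, divided by `e^{2αx}`. -/
noncomputable def wronsk (α β m : ℝ) (g : smoothFun ℝ) (x : ℝ) : ℝ :=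
  Real.exp (-α * x) * Real.cos (β * (x - m)) * (jet x 1 g - α * jet x 0 g) +
    β * (Real.exp (-α * x) * Real.sin (β * (x - m))) * jet x 0 g

theorem hasDerivAt_shift (β m x : ℝ) : HasDerivAt (fun x => β * (x - m)) β x := by
  simpa using ((hasDerivAt_id x).sub_const m).const_mul β

/-- The bracket is the quadratic operator with roots `α ± iβ`, so zeros of the Wronskian give zeros
of that operator applied to `g`. -/
theorem hasDerivAt_wronsk (α β m : ℝ) (g : smoothFun ℝ) (x : ℝ) :
    HasDerivAt (wronsk α β m g) (Real.exp (-α * x) * Real.cos (β * (x - m)) *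
      (jet x 2 g - 2 * α * jet x 1 g + (α ^ 2 + β ^ 2) * jet x 0 g)) x := by
  have h0 := hasDerivAt_jet x 0 g
  have h1 := hasDerivAt_jet x 1 g
  have he := hasDerivAt_exp_mul (-α) x
  have hs := hasDerivAt_shift β m x
  refine (((he.mul hs.cos).mul (h1.sub (h0.const_mul α))).add
    (((he.mul hs.sin).const_mul β).mul h0)).congr_deriv ?_
  simp only [Pi.mul_apply, Pi.sub_apply]
  ring

/-- Rolle for `g / (e^{αx} cos (β (x - m)))`, whose derivative is the Wronskian over a square. -/
theorem rolle_wronsk {α β m : ℝ} (g : smoothFun ℝ) {x y : ℝ} (hxy : x < y)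
    (hcos : ∀ t ∈ Set.Icc x y, Real.cos (β * (t - m)) ≠ 0)
    (hx : g.1 x = 0) (hy : g.1 y = 0) : ∃ z ∈ Set.Ioo x y, wronsk α β m g z = 0 := by
  have hd (t : ℝ) (ht : t ∈ Set.Icc x y) :
      HasDerivAt (fun t => Real.exp (-α * t) * g.1 t / Real.cos (β * (t - m)))
      (wronsk α β m g t / Real.cos (β * (t - m)) ^ 2) t := by
    refine (((hasDerivAt_exp_mul (-α) t).mul (smoothFun_hasDerivAt g t)).div
      (hasDerivAt_shift β m t).cos (hcos t ht)).congr_deriv ?_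
    rw [wronsk, jet_zero]
    simp only [Pi.mul_apply]
    ring
  obtain ⟨z, hz, h0⟩ := exists_hasDerivAt_eq_zero hxy
    (fun t ht => (hd t ht).continuousAt.continuousWithinAt) (by simp [hx, hy])
    (fun t ht => hd t (Set.Ioo_subset_Icc_self ht))
  exact ⟨z, hz, (div_eq_zero_iff.1 h0).resolve_right
    (pow_ne_zero _ (hcos z (Set.Ioo_subset_Icc_self hz)))⟩

theorem natDegree_quadratic (p q : ℝ) : (X ^ 2 - C p * X + C q : ℝ[X]).natDegree = 2 := by
  compute_degree!

theorem aeval_quadratic (p q : ℝ) (g : smoothFun ℝ) (x : ℝ) :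
    (aeval (derivOp ℝ) (X ^ 2 - C p * X + C q) g).1 x =
      jet x 2 g - p * jet x 1 g + q * jet x 0 g := by
  have : aeval (derivOp ℝ) (X ^ 2 - C p * X + C q) g =
      (derivOp ℝ ^ 2) g - p • (derivOp ℝ ^ 1) g + q • g := by
    simp [Module.algebraMap_end_apply]
  rw [this]
  rfl

/-- Centring at the midpoint keeps the argument below `|β| (b - a) / 2 < π / 2`; this is where the
length bound enters the zero count. -/
theorem cos_shift_pos {β : ℝ} (hβ : |β| * (b - a) < Real.pi) {x : ℝ} (hx : x ∈ Set.Icc a b) :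
    0 < Real.cos (β * (x - (a + b) / 2)) := by
  refine Real.cos_pos_of_mem_Ioo (abs_lt.1 ?_)
  rw [abs_mul]
  have h1 : |x - (a + b) / 2| ≤ (b - a) / 2 := abs_le.2 ⟨by linarith [hx.1], by linarith [hx.2]⟩
  nlinarith [mul_le_mul_of_nonneg_left h1 (abs_nonneg β)]

/-- A nonzero solution of `P(D) g = 0` has fewer than `deg P` zeros in `[a, b]`, if all roots `z`
of `P` satisfy `|Im z| (b - a) < π`. Here `i` and `j` are multiplicities at the endpoints, and `S`
is a set of zeros inside. -/
theorem eq_zero_of_zeros (hab : a < b) {P : ℝ[X]} (hP : P ≠ 0)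
    (hroots : ∀ z : ℂ, aeval z P = 0 → |z.im| * (b - a) < Real.pi) {g : smoothFun ℝ}
    (hg : aeval (derivOp ℝ) P g = 0) {i j : ℕ} {S : Finset ℝ} (hS : ∀ x ∈ S, x ∈ Set.Ioo a b)
    (hgS : ∀ x ∈ S, g.1 x = 0) (hi : ∀ k < i, jet a k g = 0) (hj : ∀ k < j, jet b k g = 0)
    (hcard : P.natDegree ≤ i + S.card + j) : g = 0 := by
  induction hd : P.natDegree using Nat.strong_induction_on generalizing P g i j S with
  | _ d ih =>
  rcases Nat.eq_zero_or_pos d with rfl | hd0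
  · obtain ⟨c, rfl⟩ := natDegree_eq_zero.1 hd
    rw [aeval_C, Module.algebraMap_end_apply] at hg
    exact (smul_eq_zero.1 hg).resolve_left (by simpa using hP)
  obtain ⟨x₀, hx₀, hgx₀⟩ : ∃ x ∈ Set.Icc a b, g.1 x = 0 := by
    rcases S.eq_empty_or_nonempty with rfl | ⟨x, hx⟩
    · rcases Nat.eq_zero_or_pos i with rfl | hi0
      · exact ⟨b, Set.right_mem_Icc.2 hab.le, hj 0 (by simp at hcard; omega)⟩
      · exact ⟨a, Set.left_mem_Icc.2 hab.le, hi 0 hi0⟩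
    · exact ⟨x, Set.Ioo_subset_Icc_self (hS x hx), hgS x hx⟩
  obtain ⟨z, hz⟩ : ∃ z : ℂ, aeval z P = 0 := by
    obtain ⟨z, hz⟩ := IsAlgClosed.exists_root (P.map (algebraMap ℝ ℂ)) (by
      rw [degree_map, degree_eq_natDegree hP]
      exact_mod_cast (by omega : P.natDegree ≠ 0))
    exact ⟨z, by rwa [IsRoot.def, eval_map_algebraMap] at hz⟩
  by_cases hzim : z.im = 0
  · obtain ⟨Q, rfl⟩ : X - C z.re ∣ P := by
      rw [dvd_iff_isRoot, IsRoot.def]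
      have hz' : z = ((z.re : ℝ) : ℂ) := Complex.ext rfl (by simp [hzim])
      rw [hz', ← Complex.coe_algebraMap, aeval_algebraMap_apply] at hz
      simpa using hz
    have hQ : Q ≠ 0 := right_ne_zero_of_mul hP
    rw [natDegree_mul (X_sub_C_ne_zero _) hQ, natDegree_X_sub_C] at hd hcard
    obtain ⟨T, hT, hgT, hTc⟩ := exists_zeros_of_rolle hab
      (fun x _ y _ hxy hx hy => rolle_first_order z.re g hxy hx hy) hS hgS (hi 0) (hj 0)
    -- Rolle costs one zero in all: each endpoint order drops by at most one, and the distinct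
    -- endpoint zeros were used to produce `T`. So `(D - z.re) g` still has `deg Q` zeros.
    have h0 : aeval (derivOp ℝ) (X - C z.re) g = 0 :=
      ih Q.natDegree (by omega) hQ (fun w hw => hroots w (by rw [map_mul, hw, mul_zero]))
        (by rwa [mul_comm, map_mul, Module.End.mul_apply] at hg) hT hgT
        (jet_aeval_eq_zero (natDegree_X_sub_C _).le hi)
        (jet_aeval_eq_zero (natDegree_X_sub_C _).le hj) (by omega) rfl
    refine eq_zero_of_jet_eq_zero_real (X_sub_C_ne_zero z.re) h0 (x₀ := x₀) fun k hk => ?_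
    rw [natDegree_X_sub_C, Nat.lt_one_iff] at hk
    subst hk
    exact hgx₀
  · obtain ⟨Q, rfl⟩ := quadratic_dvd_of_aeval_eq_zero_im_ne_zero P hz hzim
    have hL := natDegree_quadratic (2 * z.re) (‖z‖ ^ 2)
    have hQ : Q ≠ 0 := right_ne_zero_of_mul hP
    have hLne := left_ne_zero_of_mul hP
    rw [natDegree_mul hLne hQ, hL] at hd hcard
    have hcos (x) (hx : x ∈ Set.Icc a b) := (cos_shift_pos (hroots z hz) hx).ne'
    set m := (a + b) / 2
    have hW (x : ℝ) : HasDerivAt (wronsk z.re z.im m g) (Real.exp (-z.re * x) *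
        Real.cos (z.im * (x - m)) *
          (aeval (derivOp ℝ) (X ^ 2 - C (2 * z.re) * X + C (‖z‖ ^ 2)) g).1 x) x := by
      refine (hasDerivAt_wronsk z.re z.im m g x).congr_deriv ?_
      rw [aeval_quadratic, Complex.sq_norm, Complex.normSq_apply]
      ring
    have hWi : 0 < i - 1 → wronsk z.re z.im m g a = 0 := fun h => by
      simp [wronsk, hi 0 (by omega), hi 1 (by omega)]
    have hWj : 0 < j - 1 → wronsk z.re z.im m g b = 0 := fun h => by
      simp [wronsk, hj 0 (by omega), hj 1 (by omega)]
    -- Two Rolle steps, from `g` to the Wronskian and on to the quadratic operator, cost two zeros,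
    -- the degree of the factor.
    obtain ⟨T, hT, hgT, hTc⟩ := exists_zeros_of_rolle hab
      (fun x hx y hy hxy h1 h2 => rolle_wronsk (α := z.re) g hxy
        (fun t ht => hcos t ⟨hx.1.trans ht.1, ht.2.trans hy.2⟩) h1 h2) hS hgS (hi 0) (hj 0)
    obtain ⟨T', hT', hgT', hTc'⟩ := exists_zeros_of_rolle hab
      (ψ := (aeval (derivOp ℝ) (X ^ 2 - C (2 * z.re) * X + C (‖z‖ ^ 2)) g).1)
      (fun x hx y hy hxy h1 h2 => by
        obtain ⟨t, ht, h0⟩ := exists_hasDerivAt_eq_zero hxy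
          (fun t _ => (hW t).continuousAt.continuousWithinAt) (h1.trans h2.symm) (fun t _ => hW t)
        exact ⟨t, ht, (mul_eq_zero.1 h0).resolve_left (mul_ne_zero (Real.exp_ne_zero _)
          (hcos t ⟨hx.1.trans ht.1.le, ht.2.le.trans hy.2⟩))⟩)
      hT hgT hWi hWj
    have h0 : aeval (derivOp ℝ) (X ^ 2 - C (2 * z.re) * X + C (‖z‖ ^ 2)) g = 0 :=
      ih Q.natDegree (by omega) hQ (fun w hw => hroots w (by rw [map_mul, hw, mul_zero]))
        (by rwa [mul_comm, map_mul, Module.End.mul_apply] at hg) hT' hgT'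
        (jet_aeval_eq_zero hL.le hi) (jet_aeval_eq_zero hL.le hj) (by omega) rfl
    obtain ⟨x₁, hx₁⟩ : ∃ x, wronsk z.re z.im m g x = 0 := by
      rcases T.eq_empty_or_nonempty with rfl | ⟨x, hx⟩
      · rcases Nat.eq_zero_or_pos (i - 1) with hi0 | hi0
        · exact ⟨b, hWj (by simp at hTc; omega)⟩
        · exact ⟨a, hWi hi0⟩
      · exact ⟨x, hgT x hx⟩
    -- The Wronskian is now constant and has a zero, so it vanishes at the zero `x₀` of `g`, which
    -- forces `g' x₀ = 0`.
    have hWx : wronsk z.re z.im m g x₀ = 0 := by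
      rw [← hx₁]
      refine is_const_of_deriv_eq_zero (fun x => (hW x).differentiableAt) (fun x => ?_) _ _
      rw [(hW x).deriv, h0]
      exact mul_zero _
    have hg1 : jet x₀ 1 g = 0 := by
      rw [wronsk, jet_zero, hgx₀] at hWx
      simpa [hcos x₀ hx₀, Real.exp_ne_zero] using hWx
    refine eq_zero_of_jet_eq_zero_real hLne h0 (x₀ := x₀) fun k hk => ?_
    rw [hL] at hk
    interval_cases k
    exacts [hgx₀, hg1]

end Zeros

/-! ### Sign of a function beside a zero of known order. -/

section Sign

open Filter Topology

/-- By induction `f'` is positive just right of `c`, so `f` increases from `f c = 0`. On the left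
each integration flips the sign. -/
theorem eventually_pos_right {c : ℝ} {m : ℕ} {f : smoothFun ℝ} (h0 : ∀ j < m, jet c j f = 0)
    (hm : 0 < jet c m f) : ∀ᶠ x in 𝓝[>] c, 0 < f.1 x := by
  induction m generalizing f with
  | zero =>
    exact ((smoothFun_contDiff f).continuous.continuousAt.eventually_const_lt hm).filter_mono
      nhdsWithin_le_nhds
  | succ m ih =>
    have h := ih (f := derivOp ℝ f) (fun j hj => by rw [jet_derivOp]; exact h0 _ (by omega))
      (by rwa [jet_derivOp])
    obtain ⟨d, hd, hsub⟩ := mem_nhdsGT_iff_exists_Ioo_subset.1 h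
    refine mem_nhdsGT_iff_exists_Ioo_subset.2 ⟨d, hd, fun x hx => ?_⟩
    have hmono : StrictMonoOn f.1 (Set.Ico c d) :=
      strictMonoOn_of_deriv_pos (convex_Ico c d) (smoothFun_contDiff f).continuous.continuousOn
        (by rw [interior_Ico]; exact fun y hy => hsub hy)
    have := hmono (Set.left_mem_Ico.2 hd) (Set.Ioo_subset_Ico_self hx) hx.1
    rwa [← jet_zero c, h0 0 (by omega)] at this

theorem eventually_pos_left {c : ℝ} {m : ℕ} {f : smoothFun ℝ} (h0 : ∀ j < m, jet c j f = 0)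
    (hm : 0 < jet c m f) : ∀ᶠ x in 𝓝[<] c, 0 < (-1) ^ m * f.1 x := by
  induction m generalizing f with
  | zero =>
    simp only [pow_zero, one_mul]
    exact ((smoothFun_contDiff f).continuous.continuousAt.eventually_const_lt hm).filter_mono
      nhdsWithin_le_nhds
  | succ m ih =>
    have h := ih (f := derivOp ℝ f) (fun j hj => by rw [jet_derivOp]; exact h0 _ (by omega))
      (by rwa [jet_derivOp])
    obtain ⟨d, hd, hsub⟩ := mem_nhdsLT_iff_exists_Ioo_subset.1 h
    refine mem_nhdsLT_iff_exists_Ioo_subset.2 ⟨d, hd, fun x hx => ?_⟩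
    have hmono : StrictMonoOn (fun y => (-1) ^ m * f.1 y) (Set.Ioc d c) := by
      refine strictMonoOn_of_deriv_pos (convex_Ioc d c)
        ((smoothFun_contDiff f).continuous.const_mul _).continuousOn ?_
      rw [interior_Ioc]
      intro y hy
      rw [deriv_const_mul _ (smoothFun_differentiable f y)]
      exact hsub hy
    have := hmono (Set.Ioo_subset_Ioc_self hx) (Set.right_mem_Ioc.2 hd) hx.2
    simp only [← jet_zero c, h0 0 (Nat.succ_pos m), mul_zero] at this
    change 0 < (-1) ^ (m + 1) * f.1 x
    rw [pow_succ]
    linarith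

end Sign

/-! ### The real Bernstein basis: existence, uniqueness, signs. -/

section Bernstein

variable {a b : ℝ}

/-- `P` is nonzero and its roots `z` satisfy `|Im z| (b - a) < π`. -/
def RootsInStrip (P : ℝ[X]) (a b : ℝ) : Prop :=
  P ≠ 0 ∧ ∀ z : ℂ, aeval z P = 0 → |z.im| * (b - a) < Real.pi

theorem RootsInStrip.right {P Q : ℝ[X]} (h : RootsInStrip (P * Q) a b) : RootsInStrip Q a b :=
  ⟨right_ne_zero_of_mul h.1, fun z hz => h.2 z (by rw [map_mul, hz, mul_zero])⟩

theorem RootsInStrip.eq_zero (hab : a < b) {P : ℝ[X]} (hP : RootsInStrip P a b) {g : smoothFun ℝ}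
    (hg : aeval (derivOp ℝ) P g = 0) {i j : ℕ} (hi : ∀ k < i, jet a k g = 0)
    (hj : ∀ k < j, jet b k g = 0) (hcard : P.natDegree ≤ i + j) : g = 0 :=
  eq_zero_of_zeros hab hP.1 hP.2 hg (S := ∅) (by simp) (by simp) hi hj (by simpa using hcard)

/-- The `k`-th function of the real Bernstein basis of the kernel of `P(D)`. -/
def IsBernsteinFun (P : ℝ[X]) (a b : ℝ) (k : ℕ) (u : smoothFun ℝ) : Prop :=
  aeval (derivOp ℝ) P u = 0 ∧ (∀ j < k, jet a j u = 0) ∧ jet a k u = 1 ∧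
    ∀ j, j + k + 1 < P.natDegree → jet b j u = 0

/-- The boundary conditions form a square linear system on a space of dimension `deg P`, so
injectivity, which is the zero count, gives solvability. -/
theorem exists_isBernsteinFun (hab : a < b) {P : ℝ[X]} (hP : RootsInStrip P a b) {k : ℕ}
    (hk : k < P.natDegree) : ∃ u, IsBernsteinFun P a b k u := by
  set d := P.natDegree with hd
  let K := LinearMap.ker (aeval (derivOp ℝ) P)
  let J : K →ₗ[ℝ] Fin d → ℝ := LinearMap.pi fun j => jet a j ∘ₗ K.subtype
  -- The jets of order `0, …, k` at `a` and `0, …, d - k - 2` at `b`.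
  let M : K →ₗ[ℝ] Fin d → ℝ := LinearMap.pi fun j =>
    (if (j : ℕ) ≤ k then jet a j else jet b (j - k - 1)) ∘ₗ K.subtype
  have hsub (f g : K) : aeval (derivOp ℝ) P (f.1 - g.1) = 0 := by
    rw [map_sub, LinearMap.mem_ker.1 f.2, LinearMap.mem_ker.1 g.2, sub_zero]
  have hJ : Function.Bijective J := by
    refine ⟨fun f g hfg => Subtype.ext (sub_eq_zero.1 ?_), fun y => ?_⟩
    · refine eq_zero_of_jet_eq_zero_real hP.1 (hsub f g) (x₀ := a) fun j hj => ?_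
      rw [map_sub, sub_eq_zero]
      exact congrFun hfg ⟨j, hj⟩
    · obtain ⟨f, hf, hj⟩ := exists_jet_eq_real hP.1 a fun j => if h : j < d then y ⟨j, h⟩ else 0
      refine ⟨⟨f, hf⟩, funext fun j => ?_⟩
      exact (hj j j.2).trans (by simp)
  have hM : Function.Injective M := by
    refine fun f g hfg => Subtype.ext (sub_eq_zero.1 ?_)
    refine hP.eq_zero hab (hsub f g) (i := k + 1) (j := d - 1 - k) (fun j hj => ?_)
      (fun j hj => ?_) (by omega)
    · have := congrFun hfg ⟨j, by omega⟩
      rw [map_sub, sub_eq_zero]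
      simpa [M, show j ≤ k by omega] using this
    · have := congrFun hfg ⟨j + k + 1, by omega⟩
      rw [map_sub, sub_eq_zero]
      simpa [M, show ¬ j + k + 1 ≤ k by omega, show j + k + 1 - k - 1 = j by omega] using this
  let e := LinearEquiv.ofBijective J hJ
  have hs : Function.Surjective (M ∘ₗ (e.symm : (Fin d → ℝ) →ₗ[ℝ] K)) :=
    LinearMap.injective_iff_surjective.1 (hM.comp e.symm.injective)
  obtain ⟨y, hy⟩ := hs fun j => if (j : ℕ) = k then 1 else 0
  have hu : M (e.symm y) = fun j : Fin d => if (j : ℕ) = k then (1 : ℝ) else 0 := hy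
  refine ⟨(e.symm y).1, (e.symm y).2, fun j hj => ?_, ?_, fun j hj => ?_⟩
  · have := congrFun hu ⟨j, by omega⟩
    simpa [M, hj.le, hj.ne] using this
  · have := congrFun hu ⟨k, hk⟩
    simpa [M] using this
  · have := congrFun hu ⟨j + k + 1, hj⟩
    simpa [M, show ¬ j + k + 1 ≤ k by omega, show j + k + 1 - k - 1 = j by omega,
      show j + k + 1 ≠ k by omega] using this

theorem IsBernsteinFun.ne_zero {P : ℝ[X]} {k : ℕ} {u : smoothFun ℝ}
    (hu : IsBernsteinFun P a b k u) : u ≠ 0 := by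
  rintro rfl
  simpa using hu.2.2.1

theorem IsBernsteinFun.unique (hab : a < b) {P : ℝ[X]} (hP : RootsInStrip P a b) {k : ℕ}
    {u v : smoothFun ℝ} (hu : IsBernsteinFun P a b k u) (hv : IsBernsteinFun P a b k v) :
    u = v := by
  refine sub_eq_zero.1 (hP.eq_zero hab (i := k + 1) (j := P.natDegree - 1 - k) ?_
    (fun j hj => ?_) (fun j hj => ?_) (by omega))
  · rw [map_sub, hu.1, hv.1, sub_zero]
  · rw [map_sub]
    rcases Nat.lt_succ_iff_lt_or_eq.1 hj with hj | rfl
    · rw [hu.2.1 j hj, hv.2.1 j hj, sub_zero]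
    · rw [hu.2.2.1, hv.2.2.1, sub_self]
  · rw [map_sub, hu.2.2.2 j (by omega), hv.2.2.2 j (by omega), sub_zero]

theorem IsBernsteinFun.jet_right_ne_zero (hab : a < b) {P : ℝ[X]} (hP : RootsInStrip P a b)
    {k : ℕ} {u : smoothFun ℝ} (hu : IsBernsteinFun P a b k u) :
    jet b (P.natDegree - 1 - k) u ≠ 0 := by
  intro h
  refine hu.ne_zero (hP.eq_zero hab hu.1 hu.2.1 (j := P.natDegree - 1 - k + 1) (fun j hj => ?_)
    (by omega))
  rcases Nat.lt_succ_iff_lt_or_eq.1 hj with hj | rfl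
  · exact hu.2.2.2 j (by omega)
  · exact h

/-- The endpoint zeros already number `deg P - 1`, so there is none inside; the normalization at `a`
fixes the sign. -/
theorem IsBernsteinFun.pos (hab : a < b) {P : ℝ[X]} (hP : RootsInStrip P a b)
    {k : ℕ} {u : smoothFun ℝ} (hu : IsBernsteinFun P a b k u) {x : ℝ} (hx : x ∈ Set.Ioo a b) :
    0 < u.1 x := by
  have hne : ∀ y ∈ Set.Ioo a b, u.1 y ≠ 0 := fun y hy h0 =>
    hu.ne_zero (eq_zero_of_zeros hab hP.1 hP.2 hu.1 (S := {y}) (by simpa using hy)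
      (by simpa using h0)
      hu.2.1 (j := P.natDegree - 1 - k) (fun j hj => hu.2.2.2 j (by omega))
      (by rw [Finset.card_singleton]; omega))
  have h1 := eventually_pos_right hu.2.1 (by rw [hu.2.2.1]; exact one_pos)
  obtain ⟨y, hy, hyab⟩ := (h1.and (Ioo_mem_nhdsGT hab)).exists
  by_contra hneg
  obtain ⟨z, hz, hz0⟩ := isPreconnected_Ioo.intermediate_value hx hyab
    (smoothFun_contDiff u).continuous.continuousOn ⟨not_lt.1 hneg, hy.le⟩
  exact hne z hz hz0

theorem IsBernsteinFun.sign_jet_right (hab : a < b) {P : ℝ[X]} (hP : RootsInStrip P a b)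
    {k : ℕ} {u : smoothFun ℝ} (hu : IsBernsteinFun P a b k u) :
    0 < (-1) ^ (P.natDegree - 1 - k) * jet b (P.natDegree - 1 - k) u := by
  by_contra hneg
  set m := P.natDegree - 1 - k with hm
  have hsq : ((-1 : ℝ) ^ m) * (-1) ^ m = 1 := by rw [← mul_pow]; simp
  have hlt : (-1) ^ m * jet b m u < 0 := lt_of_le_of_ne (not_lt.1 hneg)
    (mul_ne_zero (pow_ne_zero _ (by norm_num)) (hu.jet_right_ne_zero hab hP))
  have h1 := eventually_pos_left (f := (-(-1 : ℝ) ^ m) • u) (c := b) (m := m)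
    (fun j hj => by rw [map_smul, hu.2.2.2 j (by omega), smul_zero])
    (by rw [map_smul, smul_eq_mul]; linarith)
  obtain ⟨y, hy, hyab⟩ := (h1.and (Ioo_mem_nhdsLT hab)).exists
  have h2 := hu.pos hab hP hyab
  have h3 : (-1 : ℝ) ^ m * ((-(-1 : ℝ) ^ m) • u).1 y = - u.1 y := by
    change (-1 : ℝ) ^ m * ((-(-1 : ℝ) ^ m) * u.1 y) = - u.1 y
    linear_combination (-u.1 y) * hsq
  linarith

theorem sum_smul_apply_left {P : ℝ[X]} {n : ℕ} {p : ℕ → smoothFun ℝ}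
    (hp : ∀ k ≤ n, IsBernsteinFun P a b k (p k)) (c : ℕ → ℝ) :
    (∑ k ∈ Finset.range (n + 1), c k • p k).1 a = c 0 := by
  rw [← jet_zero, map_sum, Finset.sum_eq_single 0]
  · rw [map_smul, (hp 0 (Nat.zero_le n)).2.2.1, smul_eq_mul, mul_one]
  · intro k hk h0
    rw [map_smul, (hp k (by simpa [Nat.lt_succ_iff] using hk)).2.1 0 (by omega), smul_zero]
  · simp

/-- A linear combination of the Bernstein basis that vanishes on `[a, b]` is trivial. -/
theorem coeff_eq_zero_of_sum_eq_zero (hab : a < b) {P : ℝ[X]} (hP : RootsInStrip P a b) {n : ℕ}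
    {p : ℕ → smoothFun ℝ} (hp : ∀ k ≤ n, IsBernsteinFun P a b k (p k)) {c : ℕ → ℝ}
    (h : ∀ x ∈ Set.Icc a b, (∑ k ∈ Finset.range (n + 1), c k • p k).1 x = 0) :
    ∀ k ≤ n, c k = 0 := by
  have hz : ∑ k ∈ Finset.range (n + 1), c k • p k = 0 := by
    -- Any `deg P` interior points suffice to make the combination vanish identically; its
    -- coefficients are then read off triangularly from the jets at `a`.
    obtain ⟨S, hS, hSc⟩ := Set.Infinite.exists_subset_card_eq (Set.Ioo_infinite hab) P.natDegree
    refine eq_zero_of_zeros hab hP.1 hP.2 ?_ (S := S) (fun x hx => hS hx)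
      (fun x hx => h x (Set.Ioo_subset_Icc_self (hS hx))) (i := 0) (j := 0) (by simp) (by simp)
      (by omega)
    rw [map_sum]
    refine Finset.sum_eq_zero fun k hk => ?_
    rw [map_smul, (hp k (by simpa [Nat.lt_succ_iff] using hk)).1, smul_zero]
  intro k
  induction k using Nat.strong_induction_on with
  | _ k ih =>
  intro hk
  have h1 := congrArg (jet a k) hz
  rw [map_zero, map_sum, Finset.sum_eq_single k] at h1
  · rwa [map_smul, (hp k hk).2.2.1, smul_eq_mul, mul_one] at h1
  · intro j hj hjk
    have hjn : j ≤ n := by simpa [Nat.lt_succ_iff] using hj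
    rw [map_smul, smul_eq_mul]
    rcases lt_or_gt_of_ne hjk with hlt | hgt
    · rw [ih j hlt hjn, zero_mul]
    · rw [(hp j hjn).2.1 k hgt, mul_zero]
  · intro hk'
    exact absurd (Finset.mem_range.2 (Nat.lt_succ_of_le hk)) hk'

/-! ### Coefficients of `e^{rx}` and `x e^{rx}`. -/

/-- The operator `D - r` in terms of the Bernstein bases of `(D - r) Q(D)` and `Q(D)`. -/
theorem exists_derivative_coeff (hab : a < b) {r : ℝ} {Q : ℝ[X]}
    (hP : RootsInStrip ((X - C r) * Q) a b) {n : ℕ} (hn : Q.natDegree = n)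
    {p q : ℕ → smoothFun ℝ} (hp : ∀ k ≤ n, IsBernsteinFun ((X - C r) * Q) a b k (p k))
    (hq : ∀ k < n, IsBernsteinFun Q a b k (q k)) :
    ∃ β : ℕ → ℝ, (∀ k < n, β k < 0) ∧ ∀ k ≤ n, aeval (derivOp ℝ) (X - C r) (p k) =
      (if k = 0 then 0 else q (k - 1)) + if k < n then β k • q k else 0 := by
  have hQ := hP.right
  have hdeg : ((X - C r) * Q).natDegree = n + 1 := by
    rw [natDegree_mul (X_sub_C_ne_zero r) hQ.1, natDegree_X_sub_C, hn, add_comm]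
  have hq0 (k) (hk : k < n) : jet b (n - 1 - k) (q k) ≠ 0 := by
    simpa [hn] using (hq k hk).jet_right_ne_zero hab hQ
  -- `β k` compares leading terms at `b`, where `q (k-1)` vanishes to higher order. The two orders
  -- have opposite parity, whence the negative sign.
  refine ⟨fun k => jet b (n - k) (p k) / jet b (n - 1 - k) (q k), fun k hk => ?_, fun k hk => ?_⟩
  · have h1 := (hp k hk.le).sign_jet_right hab hP
    have h2 := (hq k hk).sign_jet_right hab hQ
    rw [hdeg, Nat.add_sub_cancel, show n - k = (n - 1 - k) + 1 by omega] at h1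
    rw [hn] at h2
    beta_reduce
    rw [show n - k = (n - 1 - k) + 1 by omega]
    have h3 := div_pos h1 h2
    rw [pow_succ, mul_comm _ (-1 : ℝ), mul_assoc, mul_div_assoc,
      mul_div_mul_left _ _ (pow_ne_zero _ (by norm_num))] at h3
    linarith
  -- The difference solves `Q(D) g = 0` and has `k + (n - k) = deg Q` zeros.
  refine sub_eq_zero.1 (hQ.eq_zero hab (i := k) (j := n - k) ?_ (fun j hj => ?_)
    (fun j hj => ?_) (by omega))
  · have h1 : aeval (derivOp ℝ) Q (aeval (derivOp ℝ) (X - C r) (p k)) = 0 := by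
      rw [← Module.End.mul_apply, ← map_mul, mul_comm, (hp k hk).1]
    rw [map_sub, h1, map_add]
    split_ifs with h0 h2 h2
    · rw [map_smul, (hq k h2).1]; simp
    · simp
    · rw [map_smul, (hq k h2).1, (hq (k - 1) (by omega)).1]; simp
    · rw [(hq (k - 1) (by omega)).1]; simp
  · have h1 : jet a j (if k < n then (jet b (n - k) (p k) / jet b (n - 1 - k) (q k)) • q k else 0)
        = 0 := by
      split_ifs with h2
      · rw [map_smul, (hq k h2).2.1 j hj, smul_zero]
      · exact map_zero _
    rw [map_sub, map_add, h1, jet_X_sub_C, (hp k hk).2.1 j hj, if_neg (by omega)]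
    rcases Nat.lt_or_eq_of_le (Nat.succ_le_of_lt hj) with hlt | heq
    · rw [(hp k hk).2.1 (j + 1) hlt, (hq (k - 1) (by omega)).2.1 j (by omega)]
      simp
    · have h2 := (hq (k - 1) (by omega)).2.2.1
      rw [show k - 1 = j by omega] at h2 ⊢
      have h3 := (hp k hk).2.2.1
      rw [← heq, Nat.succ_eq_add_one] at h3
      rw [← heq, h2, h3]
      simp
  · have h1 : jet b j (if k = 0 then 0 else q (k - 1)) = 0 := by
      split_ifs with h2
      · exact map_zero _
      · exact (hq (k - 1) (by omega)).2.2.2 j (by omega)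
    rw [map_sub, map_add, h1, jet_X_sub_C, (hp k hk).2.2.2 j (by omega), if_pos (by omega),
      map_smul]
    rcases Nat.lt_or_eq_of_le (Nat.succ_le_of_lt hj) with hlt | heq
    · rw [(hp k hk).2.2.2 (j + 1) (by omega), (hq k (by omega)).2.2.2 j (by omega)]
      simp
    · beta_reduce
      rw [show n - 1 - k = j by omega, ← heq, smul_eq_mul, div_mul_cancel₀]
      · simp
      · have := hq0 k (by omega)
        rwa [show n - 1 - k = j by omega] at this

theorem aeval_sum_eq {r : ℝ} {n : ℕ} {p q : ℕ → smoothFun ℝ} {β : ℕ → ℝ}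
    (hβ : ∀ k ≤ n, aeval (derivOp ℝ) (X - C r) (p k) =
      (if k = 0 then 0 else q (k - 1)) + if k < n then β k • q k else 0) (c : ℕ → ℝ) :
    aeval (derivOp ℝ) (X - C r) (∑ k ∈ Finset.range (n + 1), c k • p k) =
      ∑ k ∈ Finset.range n, (c (k + 1) + β k * c k) • q k := by
  have h1 : ∀ k ∈ Finset.range (n + 1), aeval (derivOp ℝ) (X - C r) (c k • p k) =
      c k • (if k = 0 then 0 else q (k - 1)) + c k • (if k < n then β k • q k else 0) := by
    intro k hk
    rw [map_smul, hβ k (by simpa [Nat.lt_succ_iff] using hk), smul_add]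
  rw [map_sum, Finset.sum_congr rfl h1, Finset.sum_add_distrib, Finset.sum_range_succ',
    Finset.sum_range_succ (fun k => c k • (if k < n then β k • q k else 0))]
  simp only [Nat.succ_ne_zero, if_false, if_true, smul_zero, add_zero, lt_irrefl,
    Nat.add_sub_cancel]
  rw [← Finset.sum_add_distrib]
  refine Finset.sum_congr rfl fun k hk => ?_
  rw [if_pos (Finset.mem_range.1 hk), add_smul, smul_smul, mul_comm (c k)]

/-- The function `x ↦ e^{rx}`. -/
noncomputable def realExp (r : ℝ) : smoothFun ℝ :=
  ⟨fun x => Real.exp (r * x),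
    show ContDiff ℝ ∞ fun x : ℝ => Real.exp (r * x) by fun_prop⟩

/-- The function `x ↦ x e^{rx}`. -/
noncomputable def realMulExp (r : ℝ) : smoothFun ℝ :=
  ⟨fun x => x * Real.exp (r * x),
    show ContDiff ℝ ∞ fun x : ℝ => x * Real.exp (r * x) by fun_prop⟩

theorem aeval_realExp (r : ℝ) : aeval (derivOp ℝ) (X - C r) (realExp r) = 0 := by
  ext x
  rw [← jet_zero, jet_X_sub_C, (smoothFun_hasDerivAt (realExp r) x).unique (hasDerivAt_exp_mul r x)]
  exact sub_self _

theorem aeval_realMulExp (r : ℝ) :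
    aeval (derivOp ℝ) (X - C r) (realMulExp r) = realExp r := by
  ext x
  rw [← jet_zero, jet_X_sub_C, (smoothFun_hasDerivAt (realMulExp r) x).unique
    ((hasDerivAt_id x).mul (hasDerivAt_exp_mul r x))]
  change 1 * Real.exp (r * x) + x * (r * Real.exp (r * x)) - r * (x * Real.exp (r * x)) =
    Real.exp (r * x)
  ring

theorem eq_of_aeval_eq {r : ℝ} {f g : smoothFun ℝ}
    (h : aeval (derivOp ℝ) (X - C r) f = aeval (derivOp ℝ) (X - C r) g) (x₀ : ℝ)
    (h0 : f.1 x₀ = g.1 x₀) : f = g := by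
  refine sub_eq_zero.1
    (eq_zero_of_jet_eq_zero_real (X_sub_C_ne_zero r) (x₀ := x₀) ?_ fun j hj => ?_)
  · rw [map_sub, h, sub_self]
  · rw [natDegree_X_sub_C, Nat.lt_one_iff] at hj
    rw [hj, map_sub, jet_zero, jet_zero, h0, sub_self]

theorem exists_bernsteinFun_seq (hab : a < b) {P : ℝ[X]} (hP : RootsInStrip P a b) :
    ∃ q : ℕ → smoothFun ℝ, ∀ k < P.natDegree, IsBernsteinFun P a b k (q k) := by
  classical
  refine ⟨fun k => if h : k < P.natDegree then (exists_isBernsteinFun hab hP h).choose else 0,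
    fun k hk => ?_⟩
  simp only [dif_pos hk]
  exact (exists_isBernsteinFun hab hP hk).choose_spec

theorem exists_pos_coeff_exp {r : ℝ} {n : ℕ} {P : ℝ[X]} {p q : ℕ → smoothFun ℝ} {β : ℕ → ℝ}
    (hp : ∀ k ≤ n, IsBernsteinFun P a b k (p k)) (hβ0 : ∀ k < n, β k < 0)
    (hβ : ∀ k ≤ n, aeval (derivOp ℝ) (X - C r) (p k) =
      (if k = 0 then 0 else q (k - 1)) + if k < n then β k • q k else 0) :
    ∃ c : ℕ → ℝ, (∀ k ≤ n, 0 < c k) ∧ (∀ k, c (k + 1) = -β k * c k) ∧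
      ∑ k ∈ Finset.range (n + 1), c k • p k = realExp r := by
  let c : ℕ → ℝ := fun k => Real.exp (r * a) * ∏ j ∈ Finset.range k, -β j
  have hc (k) : c (k + 1) = -β k * c k := by
    simp only [c, Finset.prod_range_succ]
    ring
  refine ⟨c, fun k hk => mul_pos (Real.exp_pos _) (Finset.prod_pos fun j hj => ?_), hc, ?_⟩
  · exact neg_pos.2 (hβ0 j ((Finset.mem_range.1 hj).trans_le hk))
  · refine eq_of_aeval_eq (r := r) ?_ a ?_
    · rw [aeval_realExp, aeval_sum_eq hβ]
      refine Finset.sum_eq_zero fun k _ => ?_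
      rw [hc, neg_mul, neg_add_cancel, zero_smul]
    · rw [sum_smul_apply_left hp]
      simp [c, realExp]

/-- The coefficients of `e^{rx}` and `x e^{rx}` in the Bernstein basis. -/
theorem exists_coeff (hab : a < b) {r : ℝ} {R : ℝ[X]}
    (hP : RootsInStrip ((X - C r) * ((X - C r) * R)) a b) {n : ℕ}
    (hn : R.natDegree + 1 = n) {p : ℕ → smoothFun ℝ}
    (hp : ∀ k ≤ n, IsBernsteinFun ((X - C r) * ((X - C r) * R)) a b k (p k)) :
    ∃ c d : ℕ → ℝ, (∀ k ≤ n, 0 < c k) ∧ (∀ k < n, d k / c k < d (k + 1) / c (k + 1)) ∧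
      ∑ k ∈ Finset.range (n + 1), c k • p k = realExp r ∧
      ∑ k ∈ Finset.range (n + 1), d k • p k = realMulExp r := by
  obtain ⟨q, hq⟩ := exists_bernsteinFun_seq hab hP.right
  obtain ⟨s, hs⟩ := exists_bernsteinFun_seq hab hP.right.right
  have hdeg : ((X - C r) * R).natDegree = n := by
    rw [natDegree_mul (X_sub_C_ne_zero r) hP.right.right.1, natDegree_X_sub_C, add_comm, hn]
  rw [hdeg] at hq
  obtain ⟨β, hβ0, hβ⟩ := exists_derivative_coeff hab hP hdeg hp hq
  obtain ⟨c, hc0, hc, hcp⟩ := exists_pos_coeff_exp hp hβ0 hβ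
  have hq' : ∀ k ≤ R.natDegree, IsBernsteinFun ((X - C r) * R) a b k (q k) :=
    fun k hk => hq k (by omega)
  obtain ⟨β', hβ0', hβ'⟩ := exists_derivative_coeff hab hP.right rfl hq' hs
  obtain ⟨γ, hγ0, -, hγ⟩ := exists_pos_coeff_exp hq' hβ0' hβ'
  rw [hn] at hγ
  -- Comparing coefficients of `q k` in `(D - r)(x e^{rx}) = e^{rx}` gives the recursion; the start
  -- is the value at `a`.
  let d : ℕ → ℝ := Nat.rec (a * Real.exp (r * a)) fun k y => γ k - β k * y
  have hd (k) : d (k + 1) = γ k - β k * d k := rfl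
  refine ⟨c, d, hc0, fun k hk => ?_, hcp, ?_⟩
  · have h1 := hc0 k hk.le
    have h2 := hc0 (k + 1) hk
    have h3 : d (k + 1) / c (k + 1) = γ k / c (k + 1) + d k / c k := by
      rw [hd, sub_div, sub_eq_add_neg, add_right_inj, hc]
      have := (hβ0 k hk).ne
      field_simp
    rw [h3]
    have := div_pos (hγ0 k (by omega)) h2
    linarith
  · refine eq_of_aeval_eq (r := r) ?_ a ?_
    · rw [aeval_realMulExp, aeval_sum_eq hβ, ← hγ]
      refine Finset.sum_congr rfl fun k _ => ?_
      rw [hd, sub_add_cancel]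
    · rw [sum_smul_apply_left hp]
      rfl

end Bernstein

/-! ### Reality of the characteristic polynomial and the complex basis. -/

/-- The characteristic polynomial of `(d/dx - λ₀) ⋯ (d/dx - λₙ)`. -/
noncomputable def charPoly {n : ℕ} (Λ : Fin (n + 1) → ℂ) : ℂ[X] := ∏ j, (X - C (Λ j))

theorem natDegree_charPoly {n : ℕ} (Λ : Fin (n + 1) → ℂ) : (charPoly Λ).natDegree = n + 1 := by
  rw [charPoly, natDegree_prod _ _ fun _ _ => X_sub_C_ne_zero _]
  simp

theorem monic_charPoly {n : ℕ} (Λ : Fin (n + 1) → ℂ) : (charPoly Λ).Monic :=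
  monic_prod_of_monic _ _ fun _ _ => monic_X_sub_C _

theorem foldr_firstOrderOp (l : List ℂ) (f : smoothFun ℂ) :
    l.foldr firstOrderOp f.1 = (aeval (derivOp ℂ) (l.map fun c => X - C c).prod f).1 := by
  induction l with
  | nil => simp
  | cons c l ih =>
    rw [List.foldr_cons, ih, List.map_cons, List.prod_cons, map_mul, Module.End.mul_apply,
      aeval_X_sub_C_apply]
    rfl

theorem diffOp_eq {n : ℕ} (Λ : Fin (n + 1) → ℂ) (f : smoothFun ℂ) :
    diffOp Λ f.1 = (aeval (derivOp ℂ) (charPoly Λ) f).1 := by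
  rw [diffOp, foldr_firstOrderOp, List.map_ofFn, List.prod_ofFn]
  rfl

theorem mem_expSpace_iff {n : ℕ} {Λ : Fin (n + 1) → ℂ} (f : smoothFun ℂ) :
    f.1 ∈ expSpace Λ ↔ aeval (derivOp ℂ) (charPoly Λ) f = 0 := by
  constructor
  · rintro ⟨-, h⟩
    rw [diffOp_eq] at h
    exact Subtype.ext (funext h)
  · intro h
    refine ⟨smoothFun_contDiff f, fun x => ?_⟩
    rw [diffOp_eq, h]
    rfl

theorem jet_conj {f g : smoothFun ℂ} (h : ∀ x, g.1 x = conj (f.1 x)) (x : ℝ) (j : ℕ) :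
    jet x j g = conj (jet x j f) := by
  induction j generalizing x with
  | zero => exact h x
  | succ j ih =>
    refine (hasDerivAt_jet x j g).unique ?_
    simp_rw [ih]
    exact (Complex.conjCLE : ℂ →L[ℝ] ℂ).hasFDerivAt.comp_hasDerivAt x (hasDerivAt_jet x j f)

/-- If the solution space is closed under conjugation, the characteristic polynomial is real. -/
theorem exists_real_charPoly {n : ℕ} {Λ : Fin (n + 1) → ℂ}
    (hconj : ClosedUnderConj (expSpace Λ)) :
    ∃ P : ℝ[X], P.map (algebraMap ℝ ℂ) = charPoly Λ := by
  have hP0 := (monic_charPoly Λ).ne_zero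
  -- The fundamental solution: its initial data are real, so it equals its conjugate.
  obtain ⟨f, hf, hj⟩ := exists_jet_eq hP0 0 fun j => if j = n then 1 else 0
  rw [natDegree_charPoly] at hj
  have hg := hconj f.1 ((mem_expSpace_iff f).2 hf)
  set g : smoothFun ℂ := ⟨fun x => conj (f.1 x), hg.1⟩ with hgdef
  have hgf : g = f := by
    refine sub_eq_zero.1 (eq_zero_of_jet_eq_zero hP0 (x₀ := 0) ?_ fun j hjn => ?_)
    · rw [map_sub, hf, (mem_expSpace_iff g).1 hg, sub_zero]
    · rw [natDegree_charPoly] at hjn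
      rw [map_sub, jet_conj (f := f) (g := g) (fun _ => rfl), hj j hjn]
      split_ifs <;> simp
  have hreal (x : ℝ) (j : ℕ) : conj (jet x j f) = jet x j f := by
    rw [← jet_conj (f := f) (g := g) (fun _ => rfl), hgf]
  have hPbar : aeval (derivOp ℂ) ((charPoly Λ).map (starRingEnd ℂ)) f = 0 := by
    ext x
    have h := congrArg (fun y => conj (jet x 0 y)) hf
    simp only [jet_aeval, map_sum, map_mul, hreal, map_zero] at h
    rw [← jet_zero, jet_aeval, natDegree_map]
    simpa using h
  have hself : (charPoly Λ).map (starRingEnd ℂ) = charPoly Λ := by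
    by_contra hne
    -- The leading terms cancel, so a nonzero operator of order at most `n` kills `f`, whose first
    -- `n` jets vanish; then `f = 0`, contrary to its `n`-th jet being `1`.
    have hlt : (charPoly Λ - (charPoly Λ).map (starRingEnd ℂ)).natDegree < n + 1 := by
      rw [← natDegree_charPoly Λ]
      refine natDegree_lt_natDegree (sub_ne_zero.2 (Ne.symm hne))
        (degree_sub_lt_left (by rw [degree_map]) hP0 ?_)
      rw [leadingCoeff_map, (monic_charPoly Λ).leadingCoeff, map_one]
    have hf0 := eq_zero_of_jet_eq_zero (sub_ne_zero.2 (Ne.symm hne)) (f := f) (x₀ := 0)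
      (by rw [map_sub, LinearMap.sub_apply, hf, hPbar, sub_zero]) fun j hjn => by
        rw [hj j (by omega), if_neg (by omega)]
    have := hj n n.lt_succ_self
    rw [hf0] at this
    simp at this
  refine (mem_lifts _).1 ((lifts_iff_coeff_lifts _).2 fun k => ?_)
  have hk : conj ((charPoly Λ).coeff k) = (charPoly Λ).coeff k := by
    conv_rhs => rw [← hself]
    rw [coeff_map]
  obtain ⟨y, hy⟩ := Complex.conj_eq_iff_real.1 hk
  exact ⟨y, hy.symm⟩

theorem rootsInStrip_of_map_eq {n : ℕ} {Λ : Fin (n + 1) → ℂ} {P : ℝ[X]}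
    (hP : P.map (algebraMap ℝ ℂ) = charPoly Λ) {a b : ℝ} (hab : 0 < b - a)
    (hM : maxAbsIm Λ ≠ 0 → b - a < Real.pi / maxAbsIm Λ) : RootsInStrip P a b := by
  refine ⟨?_, fun z hz => ?_⟩
  · rintro rfl
    rw [Polynomial.map_zero] at hP
    exact (monic_charPoly Λ).ne_zero hP.symm
  · rw [← eval_map_algebraMap, hP, charPoly, eval_prod] at hz
    obtain ⟨j, -, hj⟩ := Finset.prod_eq_zero_iff.1 hz
    rw [eval_sub, eval_X, eval_C, sub_eq_zero] at hj
    have hle : |z.im| ≤ maxAbsIm Λ := by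
      rw [hj]
      exact Finset.le_sup' (fun j => |(Λ j).im|) (Finset.mem_univ j)
    have h0 : 0 ≤ maxAbsIm Λ := (abs_nonneg _).trans hle
    rcases h0.eq_or_lt with h0 | h0
    · rw [le_antisymm (h0 ▸ hle) (abs_nonneg _), zero_mul]
      exact Real.pi_pos
    · calc |z.im| * (b - a) ≤ maxAbsIm Λ * (b - a) := mul_le_mul_of_nonneg_right hle hab.le
        _ < Real.pi := by rw [mul_comm]; exact (lt_div_iff₀ h0).1 (hM h0.ne')

theorem exists_eq_mul_of_map_eq {n : ℕ} (hn : 1 ≤ n) {Λ : Fin (n + 1) → ℂ} (h01 : Λ 0 = Λ 1)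
    {r : ℝ} (hr : Λ 0 = r) {P : ℝ[X]} (hP : P.map (algebraMap ℝ ℂ) = charPoly Λ) :
    ∃ R, P = (X - C r) * ((X - C r) * R) := by
  obtain ⟨m, rfl⟩ := Nat.exists_eq_add_of_le' hn
  have h : (X - C r) * (X - C r) ∣ P := by
    rw [← map_dvd_map' (algebraMap ℝ ℂ), hP, charPoly, Fin.prod_univ_succ, Fin.prod_univ_succ,
      ← mul_assoc, Fin.succ_zero_eq_one, ← h01, hr]
    simp
  obtain ⟨R, rfl⟩ := h
  exact ⟨R, mul_assoc _ _ _⟩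

/-- The imaginary part gains a zero at `a`, since the normalizing value `1` is real, and then has
`deg P` zeros. -/
theorem eq_ofReal_of_bernstein {a b : ℝ} (hab : a < b) {P : ℝ[X]} (hP : RootsInStrip P a b) {k : ℕ}
    {g : smoothFun ℂ} (hg : aeval (derivOp ℂ) (P.map (algebraMap ℝ ℂ)) g = 0)
    (ha : ∀ j < k, jet a j g = 0) (hk : jet a k g = 1)
    (hb : ∀ j, j + k + 1 < P.natDegree → jet b j g = 0) :
    IsBernsteinFun P a b k (reMap g) ∧ ∀ x, g.1 x = (((reMap g).1 x : ℝ) : ℂ) := by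
  refine ⟨⟨?_, fun j hj => ?_, ?_, fun j hj => ?_⟩, fun x => ?_⟩
  · rw [aeval_reMap, hg, map_zero]
  · rw [jet_reMap, ha j hj, Complex.zero_re]
  · rw [jet_reMap, hk, Complex.one_re]
  · rw [jet_reMap, hb j hj, Complex.zero_re]
  · have him : reMap (Complex.I • g) = 0 := by
      refine hP.eq_zero hab (i := k + 1) (j := P.natDegree - 1 - k) ?_ (fun j hj => ?_)
        (fun j hj => ?_) (by omega)
      · rw [aeval_reMap, map_smul, hg, smul_zero, map_zero]
      · rw [jet_reMap, map_smul]
        rcases Nat.lt_succ_iff_lt_or_eq.1 hj with hj | rfl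
        · rw [ha j hj]; simp
        · rw [hk]; simp
      · rw [jet_reMap, map_smul, hb j (by omega)]; simp
    have hx : (reMap (Complex.I • g)).1 x = 0 := by rw [him]; rfl
    have hx' : (Complex.I * g.1 x).re = 0 := hx
    refine Complex.ext rfl ?_
    simpa using hx'

/-- Exactness of the zero orders comes for free: at `a` from the normalization, at `b` from
`jet_right_ne_zero`. -/
theorem isBernsteinBasis_iff {n : ℕ} {Λ : Fin (n + 1) → ℂ} {P : ℝ[X]}
    (hP : P.map (algebraMap ℝ ℂ) = charPoly Λ) {a b : ℝ} (hab : a < b) (hS : RootsInStrip P a b)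
    (p : Fin (n + 1) → ℝ → ℂ) :
    IsBernsteinBasis Λ a b p ↔
      ∀ k : Fin (n + 1), ∃ u, IsBernsteinFun P a b k u ∧ ∀ x, p k x = ((u.1 x : ℝ) : ℂ) := by
  have hdeg : P.natDegree = n + 1 := by
    rw [← natDegree_map (algebraMap ℝ ℂ), hP, natDegree_charPoly]
  constructor
  · intro h k
    obtain ⟨h1, h2, h3, h4⟩ := h k
    set g : smoothFun ℂ := ⟨p k, h1.1⟩
    have hgp : p k = g.1 := rfl
    have hg := (mem_expSpace_iff g).1 h1
    rw [← hP] at hg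
    refine ⟨reMap g, eq_ofReal_of_bernstein hab hS hg (fun j hj => ?_) ?_ (fun j hj => ?_)⟩
    · rw [jet_eq_iteratedDeriv]; exact h2.1 j hj
    · rw [jet_eq_iteratedDeriv]; exact h4
    · rw [jet_eq_iteratedDeriv]; exact h3.1 j (by omega)
  · intro h k
    obtain ⟨u, hu, hpu⟩ := h k
    have hk := k.2
    have hp : p k = (ofRealMap u).1 := _root_.funext hpu
    have hne := hu.jet_right_ne_zero hab hS
    rw [hdeg, Nat.add_sub_cancel] at hne
    rw [hp]
    have hak : iteratedDeriv (k : ℕ) (ofRealMap u).1 a = 1 := by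
      rw [← jet_eq_iteratedDeriv, jet_ofRealMap, hu.2.2.1, Complex.ofReal_one]
    refine ⟨(mem_expSpace_iff _).2 ?_, ⟨fun j hj => ?_, ?_⟩, ⟨fun j hj => ?_, ?_⟩, hak⟩
    · rw [← hP, aeval_ofRealMap, hu.1, map_zero]
    · rw [← jet_eq_iteratedDeriv, jet_ofRealMap, hu.2.1 j hj, Complex.ofReal_zero]
    · rw [hak]; exact one_ne_zero
    · rw [← jet_eq_iteratedDeriv, jet_ofRealMap, hu.2.2.2 j (by omega), Complex.ofReal_zero]
    · rw [← jet_eq_iteratedDeriv, jet_ofRealMap]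
      exact Complex.ofReal_ne_zero.2 hne

theorem existsUnique_isBernsteinBasis {n : ℕ} {Λ : Fin (n + 1) → ℂ} {P : ℝ[X]}
    (hP : P.map (algebraMap ℝ ℂ) = charPoly Λ) {a b : ℝ} (hab : a < b)
    (hS : RootsInStrip P a b) : ∃! p : Fin (n + 1) → ℝ → ℂ, IsBernsteinBasis Λ a b p := by
  have hdeg : P.natDegree = n + 1 := by
    rw [← natDegree_map (algebraMap ℝ ℂ), hP, natDegree_charPoly]
  obtain ⟨q, hq⟩ := exists_bernsteinFun_seq hab hS
  refine ⟨fun k x => (((q k).1 x : ℝ) : ℂ), (isBernsteinBasis_iff hP hab hS _).2 fun k =>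
    ⟨q k, hq k (by rw [hdeg]; exact k.2), fun _ => rfl⟩, fun p hp => ?_⟩
  funext k x
  obtain ⟨u, hu, hpu⟩ := (isBernsteinBasis_iff hP hab hS p).1 hp k
  rw [hpu, hu.unique hab hS (hq k (by rw [hdeg]; exact k.2))]

/-! ### Nodes and weights of the operator. -/

theorem bernsteinOp_eq {n : ℕ} {a b : ℝ} {p : Fin (n + 1) → ℝ → ℂ} {u : ℕ → smoothFun ℝ}
    (hp : ∀ (k : Fin (n + 1)) x, p k x = (((u k).1 x : ℝ) : ℂ)) {t : Fin (n + 1) → Set.Icc a b}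
    {α : Fin (n + 1) → ℝ} {g : C(ℝ, ℂ)} {G : ℝ → ℝ} (hG : ∀ x, g x = (G x : ℂ)) {c : ℕ → ℝ}
    (hc : ∀ k : Fin (n + 1), c k = α k * G (t k)) (x : ℝ) :
    bernsteinOp p t α (g.restrict (Set.Icc a b)) x =
      (((∑ k ∈ Finset.range (n + 1), c k • u k).1 x : ℝ) : ℂ) := by
  rw [← jet_zero, map_sum, ← Fin.sum_univ_eq_sum_range (fun k => jet x 0 (c k • u k)),
    Complex.ofReal_sum, bernsteinOp]
  refine Finset.sum_congr rfl fun k _ => ?_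
  rw [map_smul, smul_eq_mul, hc, ContinuousMap.restrict_apply, hG, hp, jet_zero]
  push_cast
  ring

theorem expFun_ofReal (r x : ℝ) : expFun r x = ((Real.exp (r * x) : ℝ) : ℂ) := by
  simp [expFun]

theorem mulExpFun_ofReal (r x : ℝ) : mulExpFun r x = ((x * Real.exp (r * x) : ℝ) : ℂ) := by
  simp [mulExpFun]

/-- The coefficients of a function reproduced by the Bernstein operator are determined. -/
theorem FixesOn.coeff_eq {n : ℕ} {a b : ℝ} (hab : a < b) {P : ℝ[X]} (hP : RootsInStrip P a b)
    {p : Fin (n + 1) → ℝ → ℂ} {u : ℕ → smoothFun ℝ} (hu : ∀ k ≤ n, IsBernsteinFun P a b k (u k))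
    (hp : ∀ (k : Fin (n + 1)) x, p k x = (((u k).1 x : ℝ) : ℂ)) {t : Fin (n + 1) → Set.Icc a b}
    {α : Fin (n + 1) → ℝ} {g : C(ℝ, ℂ)} {G : smoothFun ℝ} (hG : ∀ x, g x = ((G.1 x : ℝ) : ℂ))
    {c : ℕ → ℝ} (hc : ∑ k ∈ Finset.range (n + 1), c k • u k = G)
    (h : FixesOn p t α g (Set.Icc a b)) (k : Fin (n + 1)) : α k * G.1 (t k) = c k := by
  let c' : ℕ → ℝ := fun k => if h : k < n + 1 then α ⟨k, h⟩ * G.1 (t ⟨k, h⟩) else 0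
  have hc' (k : Fin (n + 1)) : c' k = α k * G.1 (t k) := dif_pos k.2
  have h0 := coeff_eq_zero_of_sum_eq_zero hab hP hu (c := fun k => c' k - c k) (fun x hx => by
    have h1 := h x hx
    rw [bernsteinOp_eq hp hG hc', hG, ← hc] at h1
    have h2 : ∑ k ∈ Finset.range (n + 1), (c' k - c k) • u k =
        ∑ k ∈ Finset.range (n + 1), c' k • u k - ∑ k ∈ Finset.range (n + 1), c k • u k := by
      rw [← Finset.sum_sub_distrib]
      exact Finset.sum_congr rfl fun k _ => Subtype.ext <| _root_.funext fun x =>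
        sub_mul (c' k) (c k) ((u k).1 x)
    rw [h2]
    exact sub_eq_zero.2 (Complex.ofReal_injective h1)) k (Nat.lt_succ_iff.1 k.2)
  rw [← hc']
  exact sub_eq_zero.1 h0

/-- Only the last function of the Bernstein basis does not vanish at the right endpoint. -/
theorem sum_smul_apply_right {a b : ℝ} {P : ℝ[X]} {n : ℕ} (hdeg : P.natDegree = n + 1)
    {p : ℕ → smoothFun ℝ} (hp : ∀ k ≤ n, IsBernsteinFun P a b k (p k)) (c : ℕ → ℝ) :
    (∑ k ∈ Finset.range (n + 1), c k • p k).1 b = c n * (p n).1 b := by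
  rw [← jet_zero, map_sum, Finset.sum_eq_single n]
  · rw [map_smul, smul_eq_mul, jet_zero]
  · intro k hk h0
    have hkn : k ≤ n := by simpa [Nat.lt_succ_iff] using hk
    rw [map_smul, (hp k hkn).2.2.2 0 (by omega), smul_zero]
  · simp

theorem exists_unique_data {n : ℕ} {a b r : ℝ} (hab : a < b) {P : ℝ[X]} (hS : RootsInStrip P a b)
    (hdeg : P.natDegree = n + 1) {R : ℝ[X]} (hR : P = (X - C r) * ((X - C r) * R))
    {p : Fin (n + 1) → ℝ → ℂ}
    (hp : ∀ k : Fin (n + 1), ∃ u, IsBernsteinFun P a b k u ∧ ∀ x, p k x = ((u.1 x : ℝ) : ℂ)) :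
    ∃ (t : Fin (n + 1) → Set.Icc a b) (α : Fin (n + 1) → ℝ),
      (AdmissibleData t α ∧ FixesOn p t α (expFun r) Set.univ ∧
        FixesOn p t α (mulExpFun r) Set.univ) ∧
      ∀ (t' : Fin (n + 1) → Set.Icc a b) (α' : Fin (n + 1) → ℝ), AdmissibleData t' α' →
        FixesOn p t' α' (expFun r) (Set.Icc a b) → FixesOn p t' α' (mulExpFun r) (Set.Icc a b) →
        t' = t ∧ α' = α := by
  choose v hv hpv using hp
  let u : ℕ → smoothFun ℝ := fun k => if h : k < n + 1 then v ⟨k, h⟩ else 0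
  have huv (k : Fin (n + 1)) : u k = v k := dif_pos k.2
  have hu : ∀ k ≤ n, IsBernsteinFun P a b k (u k) := fun k hk => by
    have := hv ⟨k, by omega⟩
    rwa [← huv] at this
  have hpu (k : Fin (n + 1)) (x : ℝ) : p k x = (((u k).1 x : ℝ) : ℂ) := by rw [huv, hpv]
  have hRdeg : R.natDegree + 1 = n := by
    have h := hS
    rw [hR] at h
    rw [hR, natDegree_mul (X_sub_C_ne_zero r) h.right.1,
      natDegree_mul (X_sub_C_ne_zero r) h.right.right.1, natDegree_X_sub_C] at hdeg
    omega
  obtain ⟨c, d, hc0, hcd, hcs, hds⟩ := exists_coeff hab (hR ▸ hS) hRdeg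
    (fun k hk => by rw [← hR]; exact hu k hk)
  have hcpos (k : Fin (n + 1)) : 0 < c k := hc0 k (Nat.lt_succ_iff.1 k.2)
  have hτmono : Monotone fun k : Fin (n + 1) => d k / c k :=
    Fin.monotone_iff_le_succ.2 fun i => (hcd i i.2).le
  have hτ0 : d 0 / c 0 = a := by
    have h1 := sum_smul_apply_left hu c
    have h2 := sum_smul_apply_left hu d
    rw [hcs] at h1
    rw [hds] at h2
    rw [← h1, ← h2]
    exact mul_div_cancel_right₀ _ (Real.exp_ne_zero _)
  have hτn : d n / c n = b := by
    have h1 := sum_smul_apply_right hdeg hu c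
    have h2 := sum_smul_apply_right hdeg hu d
    rw [hcs] at h1
    rw [hds] at h2
    change Real.exp (r * b) = _ at h1
    change b * Real.exp (r * b) = _ at h2
    have hne : (u n).1 b ≠ 0 := fun h0 => (Real.exp_ne_zero (r * b)) (by rw [h1, h0, mul_zero])
    rw [div_eq_iff (hc0 n le_rfl).ne']
    refine mul_right_cancel₀ hne ?_
    rw [← h2, h1, mul_assoc]
  have hmem (k : Fin (n + 1)) : d k / c k ∈ Set.Icc a b := by
    constructor
    · rw [← hτ0]; exact hτmono (Fin.zero_le k)
    · rw [← hτn]; exact hτmono (Fin.le_last k)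
  have hG1 : ∀ x, expFun r x = (((realExp r).1 x : ℝ) : ℂ) := expFun_ofReal r
  have hG2 : ∀ x, mulExpFun r x = (((realMulExp r).1 x : ℝ) : ℂ) := mulExpFun_ofReal r
  -- The only solution of `α e^{rt} = c`, `α t e^{rt} = d`.
  refine ⟨fun k => ⟨d k / c k, hmem k⟩, fun k => c k * (Real.exp (r * (d k / c k)))⁻¹,
    ⟨⟨hτ0, hτn, hτmono, fun k => mul_pos (hcpos k) (inv_pos.2 (Real.exp_pos _))⟩,
      fun x _ => ?_, fun x _ => ?_⟩, fun t' α' _ h1 h2 => ?_⟩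
  · rw [bernsteinOp_eq hpu hG1 (c := c), hG1, hcs]
    intro k
    exact (inv_mul_cancel_right₀ (Real.exp_ne_zero _) _).symm
  · rw [bernsteinOp_eq hpu hG2 (c := d), hG2, hds]
    intro k
    change d k = c k * (Real.exp (r * (d k / c k)))⁻¹ * (d k / c k * Real.exp (r * (d k / c k)))
    have := (hcpos k).ne'
    have := Real.exp_ne_zero (r * (d k / c k))
    generalize Real.exp (r * (d k / c k)) = e at *
    field_simp
  · have e1 (k) : α' k * Real.exp (r * t' k) = c k := h1.coeff_eq hab hS hu hpu hG1 hcs k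
    have e2 (k) : α' k * (t' k * Real.exp (r * t' k)) = d k :=
      h2.coeff_eq hab hS hu hpu hG2 hds k
    have e3 (k) : (t' k : ℝ) = d k / c k := by
      rw [eq_div_iff (hcpos k).ne', ← e1, ← e2]
      ring
    refine ⟨funext fun k => Subtype.ext (e3 k), funext fun k => ?_⟩
    rw [← e3, ← e1, mul_inv_cancel_right₀ (Real.exp_ne_zero _)]

end ExpBernstein

theorem theorem3p8 (n : ℕ) (hn : 1 ≤ n) (Λ : Fin (n + 1) → ℂ)
    (h01 : Λ 0 = Λ 1) (hreal : (Λ 0).im = 0)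
    (hconj : ExpBernstein.ClosedUnderConj (ExpBernstein.expSpace Λ))
    (a b : ℝ) (hab : 0 < b - a)
    -- `b - a < π / Mₙ`, with `π / 0 = ∞`
    (hM : ExpBernstein.maxAbsIm Λ ≠ 0 → b - a < Real.pi / ExpBernstein.maxAbsIm Λ) :
    (∃! p : Fin (n + 1) → ℝ → ℂ, ExpBernstein.IsBernsteinBasis Λ a b p) ∧
    ∀ p : Fin (n + 1) → ℝ → ℂ, ExpBernstein.IsBernsteinBasis Λ a b p →
      ∃ (t : Fin (n + 1) → Set.Icc a b) (α : Fin (n + 1) → ℝ),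
        (ExpBernstein.AdmissibleData t α ∧
          ExpBernstein.FixesOn p t α (ExpBernstein.expFun (Λ 0)) Set.univ ∧
          ExpBernstein.FixesOn p t α (ExpBernstein.mulExpFun (Λ 0)) Set.univ) ∧
        ∀ (t' : Fin (n + 1) → Set.Icc a b) (α' : Fin (n + 1) → ℝ),
          ExpBernstein.AdmissibleData t' α' →
          ExpBernstein.FixesOn p t' α' (ExpBernstein.expFun (Λ 0)) (Set.Icc a b) →
          ExpBernstein.FixesOn p t' α' (ExpBernstein.mulExpFun (Λ 0)) (Set.Icc a b) →
          t' = t ∧ α' = α := by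
  obtain ⟨P, hP⟩ := ExpBernstein.exists_real_charPoly hconj
  have hab' : a < b := sub_pos.1 hab
  have hS := ExpBernstein.rootsInStrip_of_map_eq hP hab hM
  refine ⟨ExpBernstein.existsUnique_isBernsteinBasis hP hab' hS, fun p hp => ?_⟩
  have hr : Λ 0 = ((Λ 0).re : ℂ) := Complex.ext rfl (by simp [hreal])
  obtain ⟨R, hR⟩ := ExpBernstein.exists_eq_mul_of_map_eq hn h01 hr hP
  rw [hr]
  refine ExpBernstein.exists_unique_data hab' hS ?_ hR
    ((ExpBernstein.isBernsteinBasis_iff hP hab' hS p).1 hp)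
  rw [← Polynomial.natDegree_map (algebraMap ℝ ℂ), hP, ExpBernstein.natDegree_charPoly]
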